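/- Fix a feedforward architecture: a depth $L$, an input dimension $n_0$ and layer widths $n_1,\dots,n_L$; put $d=n_L$. There is a constant $C_{\mathrm{enc}}>0$, depending only on $(L,n_0,\dots,n_L)$, such that the following holds. Let $\psi_\ell:\mathbb R^{n_\ell}\to\mathbb R^{n_\ell}$ ($1\le \ell\le L$) be $1$-Lipschitz for the Euclidean norm, with $\psi_\ell(0)=0$ for $1\le\ell<L$. Let $\Theta$ be a nonempty parameter set and, for each $\theta\in\Theta$, let $W_\ell^\theta\in\mathbb R^{n_\ell\times n_{\ell-1}}$ be weight matrices with spectral norms $\|W^\theta_\ell\|_2\le s_\ell$, where the numbers $s_1,\dots,s_L$ do not depend on $\theta$ and $\prod_{\ell=1}^L s_\ell\le L_{\mathrm{enc}}$. Let $\Phi_\theta(q)=a_L(q)$ be the encoder given by $a_0(q)=q$, $a_\ell(q)=\psi_\ell(W^\theta_\ell a_{\ell-1}(q))$. Let $\mathcal X\subseteq\mathbb R^{n_0}$ be nonempty and bounded, $B_X=\sup_{q\in\mathcal X}\|q\|_2$, and let $\beta\in\mathbb R$. For a class $\mathcal G$ of real functions and a sample $\mathcal T=(x_1,\dots,x_m)$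 with $m\ge1$, let $$\widehat{\mathfrak R}_{\mathcal T}(\mathcal G)=\mathbb E_\zeta\Bigl[\sup_{g\in\mathcal G}\frac1m\sum_{i=1}^m\zeta_i g(x_i)\Bigr],$$ where $\zeta_1,\dots,\zeta_m$ are independent and uniform on $\{-1,1\}$. (i) Let $D\subseteq\mathcal X\times\mathbb R^d$ be a set of query-prototype pairs $x=(q,p)$ (the prototypes $p$ do not depend on $\theta$), put $\Omega_\theta(x)=\Phi_\theta(q)-p$, and suppose $\|\Omega_\theta(x)\|_2\le r$ for all $x\in D$ and $\theta\in\Theta$. Let $\mathcal G=\{x\mapsto\beta-\|\Omega_\theta(x)\|_2^2:\theta\in\Theta\}$. Then, for every $m\ge 1$ and every sample $\mathcal T$ of $m$ elements of $D$, $$\widehat{\mathfrak R}_{\mathcal T}(\mathcal G)\le C_{\mathrm{enc}}\,B_X\,L_{\mathrm{enc}}\,\frac{r}{\sqrt m}.$$ (ii) The same holds, with the same constant, for aggregated scores. Let $M\ge0$, let $\alpha_0,\dots,\alpha_M\ge0$ with $\sum_\nu\alpha_\nu=1$, and let $D\subseteq\mathcal X^{M+1}\times\mathbb R^d$ be a set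 of examples $x=((q^{(0)},\dots,q^{(M)}),p)$, consisting of $M+1$ views of a query and a prototype. Put $\bar\Omega_\theta(x)=\sum_\nu\alpha_\nu\Phi_\theta(q^{(\nu)})-p$ and suppose $\|\bar\Omega_\theta(x)\|_2\le\hat r$ for all $x\in D$ and $\theta\in\Theta$. Let $\bar{\mathcal G}=\{x\mapsto\beta-\|\bar\Omega_\theta(x)\|_2^2:\theta\in\Theta\}$. Then $\widehat{\mathfrak R}_{\mathcal T}(\bar{\mathcal G})\le C_{\mathrm{enc}}\,B_X\,L_{\mathrm{enc}}\,\hat r/\sqrt m$ for every $m\ge 1$ and every sample $\mathcal T$ of $m$ elements of $D$. -/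

import Mathlib

/- On matrices, `‖W‖` is the spectral norm: the operator norm between Euclidean spaces. -/
open scoped Matrix.Norms.L2Operator

noncomputable section

namespace OneShot

/-- `ℝᵏ` with the Euclidean norm. -/
abbrev Euc (k : ℕ) : Type := EuclideanSpace ℝ (Fin k)

/-- Weight matrices of a feedforward network of depth `L` with input dimension `n 0` and layer
widths `n 1, …, n L`; the matrix of the layer `ℓ : Fin L` maps `ℝ^(n ℓ)` to `ℝ^(n (ℓ+1))`. -/
abbrev Weights {L : ℕ} (n : Fin (L + 1) → ℕ) : Type :=
  (ℓ : Fin L) → Matrix (Fin (n ℓ.succ)) (Fin (n ℓ.castSucc)) ℝ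

/-- One nonlinearity for each layer, acting on the output space of that layer. -/
abbrev Nonlinearities {L : ℕ} (n : Fin (L + 1) → ℕ) : Type :=
  (ℓ : Fin L) → Euc (n ℓ.succ) → Euc (n ℓ.succ)

/-- The hidden states `a₀ = q`, `a_{ℓ+1} = ψ_ℓ (W_ℓ a_ℓ)` (layers numbered from `0`). -/
def hiddenState {L : ℕ} {n : Fin (L + 1) → ℕ} (ψ : Nonlinearities n) (W : Weights n)
    (q : Euc (n 0)) (i : Fin (L + 1)) : Euc (n i) :=
  Fin.induction (motive := fun i => Euc (n i)) q
    (fun ℓ a => ψ ℓ (Matrix.toEuclideanLin (W ℓ) a)) i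

/-- The encoder `Φ_W : q ↦ a_L`. -/
def encoder {L : ℕ} {n : Fin (L + 1) → ℕ} (ψ : Nonlinearities n) (W : Weights n)
    (q : Euc (n 0)) : Euc (n (Fin.last L)) :=
  hiddenState ψ W q (Fin.last L)

/-- The difference feature `Ω(x) = Φ(q) - p` of a query-prototype pair `x = (q, p)`. -/
def diffFeature {a d : ℕ} (Φ : Euc a → Euc d) (x : Euc a × Euc d) : Euc d :=
  Φ x.1 - x.2

/-- The aggregated difference feature `∑ ν, α_ν Φ(q_ν) - p` of an example that consists of
the views `q_0, …, q_M` of a query and of a prototype `p`. -/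
def aggDiffFeature {a d M : ℕ} (α : Fin (M + 1) → ℝ) (Φ : Euc a → Euc d)
    (x : (Fin (M + 1) → Euc a) × Euc d) : Euc d :=
  ∑ ν, α ν • Φ (x.1 ν) - x.2

/-- The class of the scores `x ↦ β - ‖Ω_θ(x)‖²`, `θ ∈ Θ`, of a family of features `Ω`. -/
def scoreClass {X Θ : Type*} {d : ℕ} (β : ℝ) (Ω : Θ → X → Euc d) : Set (X → ℝ) :=
  Set.range fun θ x => β - ‖Ω θ x‖ ^ 2

/-- The empirical Rademacher complexity
`𝔼_ζ [ sup_{g ∈ 𝒢} (1/m) ∑ i, ζ_i g(x_i) ]`. The signs `ζ_i` are independent and uniform on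
`{-1, 1}`, so the expectation is the average over all `2^m` sign vectors. -/
def empRademacher {X : Type*} {m : ℕ} (x : Fin m → X) (𝒢 : Set (X → ℝ)) : ℝ :=
  (∑ ζ : Fin m → ℤˣ, ⨆ g : 𝒢, (1 / (m : ℝ)) * ∑ i, ((ζ i : ℤ) : ℝ) * g.1 (x i)) / 2 ^ m

end OneShot

end

/-!
The scores depend on finitely many weights, and they do so in a Lipschitz way; chaining over the
weights then gives the rate `1 / √m` without a logarithm.

*Lipschitz dependence.* Rescale the entries of the `ℓ`-th weight matrix by `1 / s ℓ`. The
rescaled weights range over a bounded subset of `ℝ^P`, where `P` is the number of weights, and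
this subset depends on the architecture alone. By induction over the layers, using that the inner
nonlinearities fix the origin, the encoder is Lipschitz in the rescaled weights with constant a
multiple of `(∏ ℓ, s ℓ) * ‖q‖` (`norm_encoder_sub_le`). The multiple depends only on the
architecture. The output nonlinearity need not fix the origin, since only differences of encoders
occur. Prototypes cancel in these differences, and a convex combination of views obeys the same
bound. As `‖Ω‖ ≤ r`, the score `β - ‖Ω‖²` is Lipschitz with constant a multiple of
`r * B_X * L_enc`.

*Chaining.* At the scale `2⁻ᵏ` the parameter cube has `2 ^ (k P)` dyadic subcubes. Replacing each
parameter by a representative of its subcube, the Rademacher sum telescopes into links. By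
Massart's lemma (`sum_signSum_selection_le`), the links of scale `2⁻ᵏ` contribute at most a multiple
of `√m * K * (2 k + 1) / 2 ^ k`, where `K` is the Lipschitz constant, and this is summable in `k`
(`sum_signSum_le_of_lipschitz`).

Suprema are avoided throughout: the expected supremum is approached by the mean over the signs `ζ`
of the sum at a parameter `θ ζ` selected for each `ζ` (`empRademacher_range_le`).
-/

namespace OneShot

open Finset

/-! ### Massart's bound for Rademacher sums -/

/-- The value `∑ i, ζ_i t_i` of the Rademacher sum with coefficients `t` at the signs `ζ`. -/
def signSum {m : ℕ} (ζ : Fin m → ℤˣ) (t : Fin m → ℝ) : ℝ :=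
  ∑ i, ((ζ i : ℤ) : ℝ) * t i

lemma signSum_sub {m : ℕ} (ζ : Fin m → ℤˣ) (t t' : Fin m → ℝ) :
    signSum ζ (t - t') = signSum ζ t - signSum ζ t' := by
  simp [signSum, mul_sub, sum_sub_distrib]

lemma signSum_le_sum_abs {m : ℕ} (ζ : Fin m → ℤˣ) (t : Fin m → ℝ) :
    signSum ζ t ≤ ∑ i, |t i| := by
  refine sum_le_sum fun i _ => ?_
  rcases Int.units_eq_one_or (ζ i) with h | h <;> simp [h, le_abs_self, neg_le_abs]

lemma card_signs (m : ℕ) : (#(univ : Finset (Fin m → ℤˣ)) : ℝ) = 2 ^ m := by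
  simp

/-- The moment generating function of a Rademacher sum, by independence of the signs. -/
lemma sum_exp_signSum {m : ℕ} (a : ℝ) (t : Fin m → ℝ) :
    ∑ ζ : Fin m → ℤˣ, Real.exp (a * signSum ζ t) = 2 ^ m * ∏ i, Real.cosh (a * t i) := by
  have h : ∀ i, ∑ e : ℤˣ, Real.exp (a * (((e : ℤ) : ℝ) * t i)) = 2 * Real.cosh (a * t i) := by
    intro i
    rw [UnitsInt.univ, sum_pair (by decide), Real.cosh_eq]
    simp
    ring
  calc ∑ ζ : Fin m → ℤˣ, Real.exp (a * signSum ζ t)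
      = ∑ ζ : Fin m → ℤˣ, ∏ i, Real.exp (a * (((ζ i : ℤ) : ℝ) * t i)) := by
        simp [signSum, mul_sum, Real.exp_sum]
    _ = ∏ i, ∑ e : ℤˣ, Real.exp (a * (((e : ℤ) : ℝ) * t i)) := by
        rw [prod_univ_sum, Fintype.piFinset_univ]
    _ = 2 ^ m * ∏ i, Real.cosh (a * t i) := by
        rw [prod_congr rfl fun i _ => h i, prod_mul_distrib, prod_const, card_fin]

lemma sum_exp_signSum_le {m : ℕ} (a : ℝ) (t : Fin m → ℝ) :
    ∑ ζ : Fin m → ℤˣ, Real.exp (a * signSum ζ t)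
      ≤ 2 ^ m * Real.exp (a ^ 2 * (∑ i, t i ^ 2) / 2) := by
  rw [sum_exp_signSum]
  gcongr
  calc ∏ i, Real.cosh (a * t i) ≤ ∏ i, Real.exp ((a * t i) ^ 2 / 2) :=
        prod_le_prod (fun i _ => (Real.cosh_pos _).le) fun i _ => Real.cosh_le_exp_half_sq _
    _ = Real.exp (a ^ 2 * (∑ i, t i ^ 2) / 2) := by
        rw [← Real.exp_sum]
        congr 1
        rw [mul_sum, sum_div]
        exact sum_congr rfl fun i _ => by ring

/-- A Rademacher sum with fixed coefficients has mean zero. -/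
lemma sum_signSum {m : ℕ} (t : Fin m → ℝ) : ∑ ζ : Fin m → ℤˣ, signSum ζ t = 0 := by
  have h : ∑ ζ : Fin m → ℤˣ, signSum ζ t = ∑ ζ : Fin m → ℤˣ, signSum (-ζ) t :=
    (Equiv.sum_comp (Equiv.neg (Fin m → ℤˣ)) fun ζ => signSum ζ t).symm
  have h' : ∀ ζ : Fin m → ℤˣ, signSum (-ζ) t = -signSum ζ t := fun ζ => by simp [signSum]
  simp only [h', sum_neg_distrib] at h
  linarith

/-- Massart's finite class lemma. In place of a maximum over a finite class of coefficient
vectors, a vector `τ ζ` of the class is selected for each sign vector `ζ`. -/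
lemma sum_signSum_selection_le {m : ℕ} (τ : (Fin m → ℤˣ) → Fin m → ℝ) {σ c : ℝ}
    (hσ : 0 ≤ σ) (hc : 0 < c) (hτ : ∀ ζ, ∑ i, τ ζ i ^ 2 ≤ σ ^ 2)
    (hcard : (#(univ.image τ) : ℝ) ≤ Real.exp (c ^ 2 / 2)) :
    ∑ ζ, signSum ζ (τ ζ) ≤ 2 ^ m * (σ * c) := by
  rcases hσ.eq_or_lt with rfl | hσ
  · have h0 : ∀ ζ i, τ ζ i = 0 := fun ζ i => by
      have h1 : τ ζ i ^ 2 ≤ ∑ i, τ ζ i ^ 2 :=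
        single_le_sum (f := fun i => τ ζ i ^ 2) (fun i _ => sq_nonneg _) (mem_univ i)
      have h2 := hτ ζ
      exact pow_eq_zero_iff two_ne_zero |>.1 (le_antisymm (by linarith) (sq_nonneg _))
    simp [signSum, h0]
  -- the value of `a` that minimises `log N / a + a σ² / 2`, where `N = exp (c² / 2)`
  set a : ℝ := c / σ with ha
  have haσ : a * σ = c := div_mul_cancel₀ _ hσ.ne'
  have ha0 : 0 < a := div_pos hc hσ
  have hexp : ∑ ζ, Real.exp (a * signSum ζ (τ ζ)) ≤ 2 ^ m * Real.exp (c ^ 2) := by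
    calc ∑ ζ, Real.exp (a * signSum ζ (τ ζ))
        ≤ ∑ ζ : Fin m → ℤˣ, ∑ t ∈ univ.image τ, Real.exp (a * signSum ζ t) :=
          sum_le_sum fun ζ _ => single_le_sum (f := fun t => Real.exp (a * signSum ζ t))
            (fun t _ => (Real.exp_pos _).le) (mem_image_of_mem τ (mem_univ ζ))
      _ = ∑ t ∈ univ.image τ, ∑ ζ : Fin m → ℤˣ, Real.exp (a * signSum ζ t) := sum_comm
      _ ≤ ∑ t ∈ univ.image τ, 2 ^ m * Real.exp (c ^ 2 / 2) := by
          refine sum_le_sum fun t ht => (sum_exp_signSum_le a t).trans ?_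
          obtain ⟨ζ, -, rfl⟩ := mem_image.1 ht
          gcongr
          calc a ^ 2 * ∑ i, τ ζ i ^ 2 ≤ a ^ 2 * σ ^ 2 := by gcongr; exact hτ ζ
            _ = c ^ 2 := by rw [← mul_pow, haσ]
      _ = 2 ^ m * (#(univ.image τ) * Real.exp (c ^ 2 / 2)) := by
          rw [sum_const, nsmul_eq_mul]; ring
      _ ≤ 2 ^ m * (Real.exp (c ^ 2 / 2) * Real.exp (c ^ 2 / 2)) := by gcongr
      _ = 2 ^ m * Real.exp (c ^ 2) := by rw [← Real.exp_add, add_halves]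
  -- the tangent line of `exp` at `c²` takes the place of Jensen's inequality
  have htan : ∀ ζ, a * signSum ζ (τ ζ)
      ≤ (c ^ 2 - 1) + Real.exp (a * signSum ζ (τ ζ)) * Real.exp (-c ^ 2) := fun ζ => by
    have := Real.add_one_le_exp (a * signSum ζ (τ ζ) + -c ^ 2)
    rw [Real.exp_add] at this
    linarith
  have hsum : a * ∑ ζ, signSum ζ (τ ζ) ≤ 2 ^ m * c ^ 2 := by
    calc a * ∑ ζ, signSum ζ (τ ζ) = ∑ ζ, a * signSum ζ (τ ζ) := mul_sum _ _ _
      _ ≤ ∑ ζ, ((c ^ 2 - 1) + Real.exp (a * signSum ζ (τ ζ)) * Real.exp (-c ^ 2)) :=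
          sum_le_sum fun ζ _ => htan ζ
      _ = 2 ^ m * (c ^ 2 - 1) + (∑ ζ, Real.exp (a * signSum ζ (τ ζ))) * Real.exp (-c ^ 2) := by
          rw [sum_add_distrib, sum_const, nsmul_eq_mul, card_signs, sum_mul]
      _ ≤ 2 ^ m * (c ^ 2 - 1) + (2 ^ m * Real.exp (c ^ 2)) * Real.exp (-c ^ 2) := by gcongr
      _ = 2 ^ m * c ^ 2 := by
          rw [mul_assoc, ← Real.exp_add, add_neg_cancel, Real.exp_zero]; ring
  have h : a * ∑ ζ, signSum ζ (τ ζ) ≤ a * (2 ^ m * (σ * c)) := by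
    calc a * ∑ ζ, signSum ζ (τ ζ) ≤ 2 ^ m * c ^ 2 := hsum
      _ = 2 ^ m * (c * (a * σ)) := by rw [haσ]; ring
      _ = a * (2 ^ m * (σ * c)) := by ring
  exact le_of_mul_le_mul_left h ha0

/-! ### Dyadic chaining over a finite-dimensional parameter cube -/

/-- The index of the dyadic subcube of side `2⁻ᵏ` of `[0, 1)^ι` that contains a point. -/
noncomputable def dyadicCell {ι : Type*} (k : ℕ) (u : ι → ℝ) (hu : ∀ j, u j < 1) : ι → Fin (2 ^ k) :=
  fun j => ⟨⌊2 ^ k * u j⌋₊, (Nat.floor_lt' (by positivity)).2 (by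
    push_cast
    exact mul_lt_of_lt_one_right (by positivity) (hu j))⟩

lemma abs_sub_le_of_dyadicCell_eq {ι : Type*} {k : ℕ} {u u' : ι → ℝ} {hu : ∀ j, u j < 1}
    {hu' : ∀ j, u' j < 1} (h0 : ∀ j, 0 ≤ u j) (h0' : ∀ j, 0 ≤ u' j)
    (h : dyadicCell k u hu = dyadicCell k u' hu') (j : ι) : |u j - u' j| ≤ 1 / 2 ^ k := by
  have hj : ⌊2 ^ k * u j⌋₊ = ⌊2 ^ k * u' j⌋₊ := by
    simpa [dyadicCell] using congrFun h j
  have h2 : (0 : ℝ) < 2 ^ k := by positivity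
  have e1 := Nat.floor_le (mul_nonneg h2.le (h0 j))
  have e2 := Nat.lt_floor_add_one ((2 : ℝ) ^ k * u j)
  have e3 := Nat.floor_le (mul_nonneg h2.le (h0' j))
  have e4 := Nat.lt_floor_add_one ((2 : ℝ) ^ k * u' j)
  rw [hj] at e1 e2
  have he : |u j - u' j| * 2 ^ k = |2 ^ k * u j - 2 ^ k * u' j| := by
    rw [← mul_sub, abs_mul, abs_of_pos h2, mul_comm]
  rw [le_div_iff₀ h2, he, abs_le]
  constructor <;> linarith

lemma sum_chaining_weights (N : ℕ) :
    ∑ k ∈ range N, (2 * (k : ℝ) + 1) / 2 ^ k = 6 - (4 * N + 6) / 2 ^ N := by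
  induction N with
  | zero => norm_num
  | succ N ih =>
    rw [sum_range_succ, ih, pow_succ]
    field_simp
    push_cast
    ring

/-- The number of links of scale `2⁻ᵏ`, in the form that Massart's lemma takes. The square `(2 k + 1)²`
is generous, but it makes the entropy factor `2 (2 k + 1) (P + 1)` free of square roots. -/
lemma two_pow_le_exp (k P : ℕ) :
    ((2 ^ (k + 1)) ^ P * (2 ^ k) ^ P : ℝ)
      ≤ Real.exp ((2 * (2 * (k : ℝ) + 1) * (P + 1)) ^ 2 / 2) := by
  have h2 : (2 : ℝ) ≤ Real.exp 1 := by
    have := Real.add_one_le_exp (1 : ℝ); linarith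
  calc ((2 ^ (k + 1)) ^ P * (2 ^ k) ^ P : ℝ) = 2 ^ ((2 * k + 1) * P) := by
        rw [← pow_mul, ← pow_mul, ← pow_add]; congr 1; ring
    _ ≤ Real.exp 1 ^ ((2 * k + 1) * P) := by gcongr
    _ = Real.exp ((2 * k + 1) * P) := by rw [← Real.exp_nat_mul]; push_cast; simp
    _ ≤ _ := by
        gcongr
        have hy : (1 : ℝ) ≤ (2 * (k : ℝ) + 1) * (P + 1) := by
          have : (0 : ℝ) ≤ (k : ℝ) := by positivity
          have : (0 : ℝ) ≤ (P : ℝ) := by positivity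
          nlinarith
        have hx : (2 * (k : ℝ) + 1) * P ≤ (2 * (k : ℝ) + 1) * (P + 1) := by gcongr; linarith
        nlinarith

/-- Dudley's chaining bound for a process with `K`-Lipschitz coefficients over a subset of
`[0, 1)^ι`. As in `sum_signSum_selection_le`, the supremum over the parameters is replaced by a
selection `θ ζ`. The dimension enters through the number `2 ^ (k * card ι)` of dyadic cubes of
side `2⁻ᵏ`. -/
lemma sum_signSum_le_of_lipschitz {ι Θ : Type*} [Fintype ι] {m : ℕ} (u : Θ → ι → ℝ)
    (h0 : ∀ θ j, 0 ≤ u θ j) (h1 : ∀ θ j, u θ j < 1) (v : Θ → Fin m → ℝ) {K : ℝ} (hK : 0 ≤ K)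
    (hv : ∀ (θ θ' : Θ) (ε : ℝ), (∀ j, |u θ j - u θ' j| ≤ ε) → 0 ≤ ε →
      ∀ i, |v θ i - v θ' i| ≤ K * ε)
    (θ : (Fin m → ℤˣ) → Θ) :
    ∑ ζ, signSum ζ (v (θ ζ)) ≤ 2 ^ m * (24 * (Fintype.card ι + 1) * K * √m) := by
  classical
  have : Nonempty Θ := ⟨θ 1⟩
  set P := Fintype.card ι
  let cell (k : ℕ) (ϑ : Θ) : ι → Fin (2 ^ k) := dyadicCell k (u ϑ) (h1 ϑ)
  -- `π k` replaces a parameter by the representative of its dyadic cube of side `2⁻ᵏ`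
  let rep (k : ℕ) : (ι → Fin (2 ^ k)) → Θ := Function.invFun (cell k)
  let π (k : ℕ) (ϑ : Θ) : Θ := rep k (cell k ϑ)
  have hπ : ∀ k ϑ i, |v ϑ i - v (π k ϑ) i| ≤ K * (1 / 2 ^ k) := fun k ϑ i => by
    refine hv _ _ _ (fun j => ?_) (by positivity) i
    exact abs_sub_le_of_dyadicCell_eq (h0 _) (h0 _)
      (Function.invFun_eq (f := cell k) ⟨ϑ, rfl⟩).symm j
  have hlink : ∀ k : ℕ, ∑ ζ, signSum ζ (v (π (k + 1) (θ ζ)) - v (π k (θ ζ)))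
      ≤ 2 ^ m * (4 * (P + 1) * K * √m * ((2 * (k : ℝ) + 1) / 2 ^ k)) := by
    intro k
    have hent : ∀ ζ i, |(v (π (k + 1) (θ ζ)) - v (π k (θ ζ))) i| ≤ 2 * K / 2 ^ k := by
      intro ζ i
      have e1 := hπ k (θ ζ) i
      have e2 := hπ (k + 1) (θ ζ) i
      have e3 : K * (1 / 2 ^ (k + 1)) ≤ K * (1 / 2 ^ k) := by
        gcongr
        · norm_num
        · omega
      calc |v (π (k + 1) (θ ζ)) i - v (π k (θ ζ)) i|
          = |(v (θ ζ) i - v (π k (θ ζ)) i) - (v (θ ζ) i - v (π (k + 1) (θ ζ)) i)| := by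
            congr 1; ring
        _ ≤ _ := abs_sub _ _
        _ ≤ K * (1 / 2 ^ k) + K * (1 / 2 ^ k) := by linarith
        _ = 2 * K / 2 ^ k := by ring
    refine (sum_signSum_selection_le (fun ζ => v (π (k + 1) (θ ζ)) - v (π k (θ ζ)))
      (σ := 2 * K / 2 ^ k * √m) (c := 2 * (2 * (k : ℝ) + 1) * (P + 1)) (by positivity)
      (by positivity) (fun ζ => ?_) ?_).trans_eq (by ring)
    · calc ∑ i, (v (π (k + 1) (θ ζ)) - v (π k (θ ζ))) i ^ 2
          ≤ ∑ i : Fin m, (2 * K / 2 ^ k) ^ 2 :=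
            sum_le_sum fun i _ => sq_le_sq' (abs_le.1 (hent ζ i)).1 (abs_le.1 (hent ζ i)).2
        _ = (2 * K / 2 ^ k * √m) ^ 2 := by
            rw [mul_pow, Real.sq_sqrt (by positivity)]; simp [mul_comm]
    · -- a link depends only on the two cubes that it joins
      let F : (ι → Fin (2 ^ (k + 1))) × (ι → Fin (2 ^ k)) → Fin m → ℝ :=
        fun c => v (rep (k + 1) c.1) - v (rep k c.2)
      have hsub : univ.image (fun ζ => v (π (k + 1) (θ ζ)) - v (π k (θ ζ))) ⊆ univ.image F := by
        intro t ht
        obtain ⟨ζ, -, rfl⟩ := mem_image.1 ht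
        exact mem_image.2 ⟨(cell (k + 1) (θ ζ), cell k (θ ζ)), mem_univ _, rfl⟩
      have hle := (card_le_card hsub).trans card_image_le
      have hcard : #(univ : Finset ((ι → Fin (2 ^ (k + 1))) × (ι → Fin (2 ^ k))))
          = (2 ^ (k + 1)) ^ P * (2 ^ k) ^ P := by
        simp [P, Fintype.card_prod]
      rw [hcard] at hle
      exact le_trans (by exact_mod_cast hle) (two_pow_le_exp k P)
  have hbase : ∑ ζ, signSum ζ (v (π 0 (θ ζ))) = 0 := by
    have hc : ∀ ζ, π 0 (θ ζ) = π 0 (θ 1) := fun ζ => by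
      have : cell 0 (θ ζ) = cell 0 (θ 1) := by
        funext j
        exact Subsingleton.elim (α := Fin 1) _ _
      simp only [π, this]
    simp only [hc, sum_signSum]
  have hfin : ∀ N : ℕ, ∑ ζ, signSum ζ (v (π N (θ ζ)))
      ≤ 2 ^ m * (4 * (P + 1) * K * √m * ∑ k ∈ range N, (2 * (k : ℝ) + 1) / 2 ^ k) := by
    intro N
    induction N with
    | zero => simp [hbase]
    | succ N ih =>
      have h := hlink N
      simp only [signSum_sub, sum_sub_distrib] at h
      rw [sum_range_succ, mul_add, mul_add]
      linarith
  have hN : ∀ N : ℕ, ∑ ζ, signSum ζ (v (θ ζ))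
      ≤ 2 ^ m * (24 * (P + 1) * K * √m) + 2 ^ m * m * K * (1 / 2) ^ N := by
    intro N
    have hrem : ∑ ζ, signSum ζ (v (θ ζ) - v (π N (θ ζ))) ≤ 2 ^ m * m * K * (1 / 2) ^ N := by
      calc ∑ ζ, signSum ζ (v (θ ζ) - v (π N (θ ζ)))
          ≤ ∑ ζ : Fin m → ℤˣ, ∑ i : Fin m, K * (1 / 2 ^ N) :=
            sum_le_sum fun ζ _ => (signSum_le_sum_abs _ _).trans (sum_le_sum fun i _ => hπ N _ i)
        _ = 2 ^ m * m * K * (1 / 2) ^ N := by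
            rw [sum_const, sum_const, nsmul_eq_mul, nsmul_eq_mul, card_signs, card_fin,
              one_div_pow]
            ring
    have hw : ∑ k ∈ range N, (2 * (k : ℝ) + 1) / 2 ^ k ≤ 6 := by
      rw [sum_chaining_weights]
      have : (0 : ℝ) ≤ (4 * N + 6) / 2 ^ N := by positivity
      linarith
    have hmain : 2 ^ m * (4 * (P + 1) * K * √m * ∑ k ∈ range N, (2 * (k : ℝ) + 1) / 2 ^ k)
        ≤ 2 ^ m * (4 * (P + 1) * K * √m * 6) := by gcongr
    simp only [signSum_sub, sum_sub_distrib] at hrem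
    have := hfin N
    linarith
  have hlim : Filter.Tendsto
      (fun N : ℕ => 2 ^ m * (24 * (P + 1) * K * √m) + 2 ^ m * m * K * (1 / 2 : ℝ) ^ N)
      Filter.atTop (nhds (2 ^ m * (24 * (P + 1) * K * √m) + 2 ^ m * m * K * 0)) :=
    ((tendsto_pow_atTop_nhds_zero_of_lt_one (by norm_num) (by norm_num)).const_mul _).const_add _
  simpa using ge_of_tendsto' hlim hN

/-- Rademacher complexity is bounded once every selection of class members is. -/
lemma empRademacher_range_le {X Θ : Type*} [Nonempty Θ] {m : ℕ} (x : Fin m → X)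
    (g : Θ → X → ℝ) {B : ℝ}
    (hB : ∀ θ : (Fin m → ℤˣ) → Θ, ∑ ζ, signSum ζ (fun i => g (θ ζ) (x i)) ≤ 2 ^ m * (m * B))
    (hm : 0 < m) : empRademacher x (Set.range g) ≤ B := by
  have hm' : (0 : ℝ) < m := by exact_mod_cast hm
  refine le_of_forall_pos_le_add fun ε hε => ?_
  have hsel : ∀ ζ : Fin m → ℤˣ, ∃ θ : Θ,
      (⨆ f : Set.range g, (1 / (m : ℝ)) * ∑ i, ((ζ i : ℤ) : ℝ) * f.1 (x i))
        ≤ (1 / (m : ℝ)) * signSum ζ (fun i => g θ (x i)) + ε := by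
    intro ζ
    obtain ⟨⟨_, θ, rfl⟩, h⟩ := exists_lt_of_lt_ciSup (sub_lt_self
      (⨆ f : Set.range g, (1 / (m : ℝ)) * ∑ i, ((ζ i : ℤ) : ℝ) * f.1 (x i)) hε)
    exact ⟨θ, by simp only [signSum]; linarith⟩
  choose θ hθ using hsel
  rw [empRademacher, div_le_iff₀ (by positivity)]
  calc _ ≤ ∑ ζ, ((1 / (m : ℝ)) * signSum ζ (fun i => g (θ ζ) (x i)) + ε) :=
        sum_le_sum fun ζ _ => hθ ζ
    _ = (1 / (m : ℝ)) * (∑ ζ, signSum ζ (fun i => g (θ ζ) (x i))) + 2 ^ m * ε := by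
        rw [sum_add_distrib, mul_sum, sum_const, nsmul_eq_mul, card_signs]
    _ ≤ (1 / (m : ℝ)) * (2 ^ m * (m * B)) + 2 ^ m * ε := by gcongr; exact hB θ
    _ = (B + ε) * 2 ^ m := by field_simp

/-- The chaining bound for the scores `β - ‖Ω_θ‖²`: the square is `2r`-Lipschitz on the ball of
radius `r`. -/
lemma empRademacher_scoreClass_le {ι X Θ : Type*} [Fintype ι] [Nonempty Θ] {m d : ℕ}
    (hm : 0 < m) (x : Fin m → X) (β : ℝ) (Ω : Θ → X → Euc d) (u : Θ → ι → ℝ)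
    (h0 : ∀ θ j, 0 ≤ u θ j) (h1 : ∀ θ j, u θ j < 1) {r K : ℝ} (hr : 0 ≤ r) (hK : 0 ≤ K)
    (hΩr : ∀ θ i, ‖Ω θ (x i)‖ ≤ r)
    (hΩ : ∀ (θ θ' : Θ) (ε : ℝ), (∀ j, |u θ j - u θ' j| ≤ ε) → 0 ≤ ε →
      ∀ i, ‖Ω θ (x i) - Ω θ' (x i)‖ ≤ K * ε) :
    empRademacher x (scoreClass β Ω) ≤ 48 * (Fintype.card ι + 1) * K * (r / √m) := by
  refine empRademacher_range_le x _ (fun θ => ?_) hm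
  have hv : ∀ (θ θ' : Θ) (ε : ℝ), (∀ j, |u θ j - u θ' j| ≤ ε) → 0 ≤ ε →
      ∀ i, |(β - ‖Ω θ (x i)‖ ^ 2) - (β - ‖Ω θ' (x i)‖ ^ 2)| ≤ 2 * r * K * ε := by
    intro θ θ' ε hu hε i
    have e1 := (abs_norm_sub_norm_le (Ω θ' (x i)) (Ω θ (x i))).trans
      ((norm_sub_rev _ _).trans_le (hΩ θ θ' ε hu hε i))
    have e2 : |‖Ω θ' (x i)‖ + ‖Ω θ (x i)‖| ≤ 2 * r := by
      rw [abs_of_nonneg (by positivity)]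
      linarith [hΩr θ i, hΩr θ' i]
    calc |(β - ‖Ω θ (x i)‖ ^ 2) - (β - ‖Ω θ' (x i)‖ ^ 2)|
        = |‖Ω θ' (x i)‖ + ‖Ω θ (x i)‖| * |‖Ω θ' (x i)‖ - ‖Ω θ (x i)‖| := by
          rw [← abs_mul]; congr 1; ring
      _ ≤ 2 * r * (K * ε) := by gcongr
      _ = 2 * r * K * ε := by ring
  refine (sum_signSum_le_of_lipschitz u h0 h1 (fun θ i => β - ‖Ω θ (x i)‖ ^ 2) (K := 2 * r * K)
    (by positivity) hv θ).trans_eq ?_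
  have hs : (m : ℝ) / √m = √m := Real.div_sqrt
  calc _ = 2 ^ m * (48 * (Fintype.card ι + 1) * K * r * √m) := by ring
    _ = 2 ^ m * (48 * (Fintype.card ι + 1) * K * r * (m / √m)) := by rw [hs]
    _ = _ := by ring

/-! ### Dependence of the encoder on its weights -/

lemma norm_toEuclideanLin_apply_le {a b : ℕ} (A : Matrix (Fin a) (Fin b) ℝ) (x : Euc b) :
    ‖Matrix.toEuclideanLin A x‖ ≤ ‖A‖ * ‖x‖ :=
  Matrix.l2_opNorm_mulVec A x

lemma abs_entry_le_l2_opNorm {a b : ℕ} (A : Matrix (Fin a) (Fin b) ℝ) (i : Fin a) (j : Fin b) :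
    |A i j| ≤ ‖A‖ := by
  have h := norm_toEuclideanLin_apply_le A (EuclideanSpace.single j 1)
  have h' := PiLp.norm_apply_le (Matrix.toEuclideanLin A (EuclideanSpace.single j 1)) i
  simp at h h'
  exact h'.trans h

lemma l2_opNorm_le_of_abs_entry_le {a b : ℕ} (A : Matrix (Fin a) (Fin b) ℝ) {ε : ℝ}
    (hε : 0 ≤ ε) (h : ∀ i j, |A i j| ≤ ε) : ‖A‖ ≤ a * b * ε := by
  rw [Matrix.l2_opNorm_def]
  refine ContinuousLinearMap.opNorm_le_bound _ (by positivity) fun x => ?_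
  have hrow : ∀ i, ‖Matrix.toEuclideanLin A x i‖ ≤ b * ε * ‖x‖ := fun i => by
    calc ‖∑ j, A i j * x j‖ ≤ ∑ _j : Fin b, ε * ‖x‖ := by
          refine norm_sum_le_of_le _ fun j _ => ?_
          rw [norm_mul]
          exact mul_le_mul (h i j) (PiLp.norm_apply_le x j) (norm_nonneg _) hε
      _ = b * ε * ‖x‖ := by simp [mul_assoc]
  calc ‖Matrix.toEuclideanLin A x‖
      = ‖∑ i, EuclideanSpace.single i (Matrix.toEuclideanLin A x i)‖ := by
        congr 1; ext k; simp [Pi.single_apply]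
    _ ≤ ∑ _i : Fin a, b * ε * ‖x‖ :=
        norm_sum_le_of_le _ fun i _ => by simpa using hrow i
    _ = a * b * ε * ‖x‖ := by simp [mul_assoc]

/-- The indices of the weight matrices that enter the hidden state `i`. -/
def layersBelow {L : ℕ} (i : Fin (L + 1)) : Finset (Fin L) := univ.filter fun ℓ => ℓ.castSucc < i

lemma prod_layersBelow_succ {L : ℕ} (s : Fin L → ℝ) (ℓ : Fin L) :
    ∏ j ∈ layersBelow ℓ.succ, s j = s ℓ * ∏ j ∈ layersBelow ℓ.castSucc, s j := by
  have : layersBelow ℓ.succ = insert ℓ (layersBelow ℓ.castSucc) := by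
    ext j
    simp only [layersBelow, mem_filter, mem_univ, true_and, mem_insert, Fin.lt_def, Fin.ext_iff,
      Fin.val_castSucc, Fin.val_succ]
    omega
  rw [this, prod_insert (by simp [layersBelow])]

lemma layersBelow_last (L : ℕ) : layersBelow (Fin.last L) = univ := by
  ext j; simp [layersBelow, Fin.castSucc_lt_last]

lemma hiddenState_succ {L : ℕ} {n : Fin (L + 1) → ℕ} (ψ : Nonlinearities n) (W : Weights n)
    (q : Euc (n 0)) (ℓ : Fin L) :
    hiddenState ψ W q ℓ.succ
      = ψ ℓ (Matrix.toEuclideanLin (W ℓ) (hiddenState ψ W q ℓ.castSucc)) := rfl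

lemma norm_hiddenState_le {L : ℕ} {n : Fin (L + 1) → ℕ} {ψ : Nonlinearities n}
    (hψ : ∀ ℓ, LipschitzWith 1 (ψ ℓ)) (hψ0 : ∀ ℓ : Fin L, (ℓ : ℕ) + 1 < L → ψ ℓ 0 = 0)
    {s : Fin L → ℝ} {W : Weights n} (hW : ∀ ℓ, ‖W ℓ‖ ≤ s ℓ) (q : Euc (n 0)) (i : Fin (L + 1)) :
    (i : ℕ) < L → ‖hiddenState ψ W q i‖ ≤ (∏ j ∈ layersBelow i, s j) * ‖q‖ := by
  induction i using Fin.induction with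
  | zero => intro _; simp [layersBelow, hiddenState]
  | succ ℓ ih =>
    intro hℓ
    have h1 := ih (by simp)
    have h2 := (hψ ℓ).norm_sub_le
      (Matrix.toEuclideanLin (W ℓ) (hiddenState ψ W q ℓ.castSucc)) 0
    rw [hψ0 ℓ (by simpa using hℓ), sub_zero, sub_zero, NNReal.coe_one, one_mul] at h2
    have hs : 0 ≤ s ℓ := (norm_nonneg _).trans (hW ℓ)
    rw [hiddenState_succ, prod_layersBelow_succ, mul_assoc]
    calc _ ≤ _ := h2
      _ ≤ ‖W ℓ‖ * ‖hiddenState ψ W q ℓ.castSucc‖ := norm_toEuclideanLin_apply_le _ _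
      _ ≤ _ := by gcongr; exact hW ℓ

/-- Hidden states are Lipschitz in the weights, with the perturbation of each weight matrix
measured relative to its norm bound `s ℓ`. -/
lemma norm_hiddenState_sub_le {L : ℕ} {n : Fin (L + 1) → ℕ} {ψ : Nonlinearities n}
    (hψ : ∀ ℓ, LipschitzWith 1 (ψ ℓ)) (hψ0 : ∀ ℓ : Fin L, (ℓ : ℕ) + 1 < L → ψ ℓ 0 = 0)
    {s : Fin L → ℝ} {W W' : Weights n} (hW : ∀ ℓ, ‖W ℓ‖ ≤ s ℓ) (hW' : ∀ ℓ, ‖W' ℓ‖ ≤ s ℓ)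
    {δ : ℝ} (hδ : ∀ ℓ, ‖W ℓ - W' ℓ‖ ≤ s ℓ * δ) (q : Euc (n 0)) (i : Fin (L + 1)) :
    ‖hiddenState ψ W q i - hiddenState ψ W' q i‖
      ≤ (∏ j ∈ layersBelow i, s j) * ((i : ℕ) * δ) * ‖q‖ := by
  induction i using Fin.induction with
  | zero => simp [layersBelow, hiddenState]
  | succ ℓ ih =>
    have hs : 0 ≤ s ℓ := (norm_nonneg _).trans (hW ℓ)
    have hsδ : 0 ≤ s ℓ * δ := (norm_nonneg _).trans (hδ ℓ)
    have hn := norm_hiddenState_le hψ hψ0 hW q ℓ.castSucc (by simp)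
    rw [hiddenState_succ, hiddenState_succ, prod_layersBelow_succ]
    set a := hiddenState ψ W q ℓ.castSucc
    set a' := hiddenState ψ W' q ℓ.castSucc
    set p := ∏ j ∈ layersBelow ℓ.castSucc, s j
    have h2 := (hψ ℓ).norm_sub_le (Matrix.toEuclideanLin (W ℓ) a) (Matrix.toEuclideanLin (W' ℓ) a')
    rw [NNReal.coe_one, one_mul] at h2
    have hsplit : Matrix.toEuclideanLin (W ℓ) a - Matrix.toEuclideanLin (W' ℓ) a'
        = Matrix.toEuclideanLin (W ℓ - W' ℓ) a + Matrix.toEuclideanLin (W' ℓ) (a - a') := by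
      rw [map_sub, map_sub, LinearMap.sub_apply]; abel
    calc _ ≤ _ := h2
      _ ≤ ‖Matrix.toEuclideanLin (W ℓ - W' ℓ) a‖ + ‖Matrix.toEuclideanLin (W' ℓ) (a - a')‖ := by
          rw [hsplit]; exact norm_add_le _ _
      _ ≤ ‖W ℓ - W' ℓ‖ * ‖a‖ + ‖W' ℓ‖ * ‖a - a'‖ :=
          add_le_add (norm_toEuclideanLin_apply_le _ _) (norm_toEuclideanLin_apply_le _ _)
      _ ≤ s ℓ * δ * (p * ‖q‖) + s ℓ * (p * (((ℓ.castSucc : Fin (L + 1)) : ℕ) * δ) * ‖q‖) := by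
          gcongr
          · exact hδ ℓ
          · exact hW' ℓ
      _ = s ℓ * p * (((ℓ.succ : Fin (L + 1)) : ℕ) * δ) * ‖q‖ := by
          rw [Fin.val_castSucc, Fin.val_succ]; push_cast; ring

/-- Positions of the entries of all the weight matrices. -/
abbrev WeightIndex {L : ℕ} (n : Fin (L + 1) → ℕ) : Type :=
  (ℓ : Fin L) × (Fin (n ℓ.succ) × Fin (n ℓ.castSucc))

/-- The entries of the weights, rescaled by the norm bounds `s` so as to lie in
`[1/4, 3/4] ⊆ [0, 1)`. Where `s ℓ = 0` the weights of the layer vanish, and the entry is `1/2`. -/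
noncomputable def weightCoords {L : ℕ} {n : Fin (L + 1) → ℕ} (s : Fin L → ℝ) (W : Weights n) :
    WeightIndex n → ℝ :=
  fun j => W j.1 j.2.1 j.2.2 / s j.1 / 4 + 1 / 2

lemma abs_weightCoords_sub_half_le {L : ℕ} {n : Fin (L + 1) → ℕ} {s : Fin L → ℝ} {W : Weights n}
    (hW : ∀ ℓ, ‖W ℓ‖ ≤ s ℓ) (j : WeightIndex n) : |weightCoords s W j - 1 / 2| ≤ 1 / 4 := by
  have hs : 0 ≤ s j.1 := (norm_nonneg _).trans (hW j.1)
  have h := (abs_entry_le_l2_opNorm (W j.1) j.2.1 j.2.2).trans (hW j.1)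
  have h' : |W j.1 j.2.1 j.2.2 / s j.1| ≤ 1 := by
    rw [abs_div, abs_of_nonneg hs]
    exact div_le_one_of_le₀ h hs
  rw [weightCoords, add_sub_cancel_right, abs_div, abs_of_pos (by norm_num : (0 : ℝ) < 4)]
  linarith

lemma norm_weights_sub_le {L : ℕ} {n : Fin (L + 1) → ℕ} {s : Fin L → ℝ} {W W' : Weights n}
    (hW : ∀ ℓ, ‖W ℓ‖ ≤ s ℓ) (hW' : ∀ ℓ, ‖W' ℓ‖ ≤ s ℓ) {ε : ℝ} (hε : 0 ≤ ε)
    (h : ∀ j, |weightCoords s W j - weightCoords s W' j| ≤ ε) (ℓ : Fin L) :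
    ‖W ℓ - W' ℓ‖ ≤ s ℓ * (4 * Fintype.card (WeightIndex n) * ε) := by
  have hs : 0 ≤ s ℓ := (norm_nonneg _).trans (hW ℓ)
  have hent : ∀ i j, |(W ℓ - W' ℓ) i j| ≤ 4 * s ℓ * ε := by
    intro i j
    rcases hs.eq_or_lt with h0 | h0
    · have e := norm_le_zero_iff.1 ((hW ℓ).trans_eq h0.symm)
      have e' := norm_le_zero_iff.1 ((hW' ℓ).trans_eq h0.symm)
      simp [e, e', ← h0]
    · have hj := h ⟨ℓ, i, j⟩
      have : (W ℓ - W' ℓ) i j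
          = 4 * s ℓ * (weightCoords s W ⟨ℓ, i, j⟩ - weightCoords s W' ⟨ℓ, i, j⟩) := by
        simp only [weightCoords, Matrix.sub_apply]
        field_simp
        ring
      rw [this, abs_mul, abs_of_pos (by positivity : 0 < 4 * s ℓ)]
      gcongr
  have hcard : ((n ℓ.succ * n ℓ.castSucc : ℕ) : ℝ) ≤ Fintype.card (WeightIndex n) := by
    have : n ℓ.succ * n ℓ.castSucc ≤ Fintype.card (WeightIndex n) := by
      rw [Fintype.card_sigma]
      simpa using single_le_sum (f := fun ℓ : Fin L => n ℓ.succ * n ℓ.castSucc)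
        (fun _ _ => Nat.zero_le _) (mem_univ ℓ)
    exact_mod_cast this
  calc ‖W ℓ - W' ℓ‖ ≤ n ℓ.succ * n ℓ.castSucc * (4 * s ℓ * ε) :=
        l2_opNorm_le_of_abs_entry_le _ (by positivity) hent
    _ = ((n ℓ.succ * n ℓ.castSucc : ℕ) : ℝ) * (4 * s ℓ * ε) := by push_cast; ring
    _ ≤ Fintype.card (WeightIndex n) * (4 * s ℓ * ε) := by gcongr
    _ = _ := by ring

/-- The encoder is Lipschitz in the rescaled weights, with a constant that involves the norm
bounds only through their product. -/
lemma norm_encoder_sub_le {L : ℕ} {n : Fin (L + 1) → ℕ} {ψ : Nonlinearities n}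
    (hψ : ∀ ℓ, LipschitzWith 1 (ψ ℓ)) (hψ0 : ∀ ℓ : Fin L, (ℓ : ℕ) + 1 < L → ψ ℓ 0 = 0)
    {s : Fin L → ℝ} {W W' : Weights n} (hW : ∀ ℓ, ‖W ℓ‖ ≤ s ℓ) (hW' : ∀ ℓ, ‖W' ℓ‖ ≤ s ℓ)
    {L_enc B : ℝ} (hs : ∏ ℓ, s ℓ ≤ L_enc) {ε : ℝ} (hε : 0 ≤ ε)
    (h : ∀ j, |weightCoords s W j - weightCoords s W' j| ≤ ε) {q : Euc (n 0)} (hq : ‖q‖ ≤ B) :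
    ‖encoder ψ W q - encoder ψ W' q‖
      ≤ 4 * L * Fintype.card (WeightIndex n) * L_enc * B * ε := by
  have h1 := norm_hiddenState_sub_le hψ hψ0 hW hW' (norm_weights_sub_le hW hW' hε h) q (Fin.last L)
  have hs0 : 0 ≤ ∏ ℓ, s ℓ := prod_nonneg fun ℓ _ => (norm_nonneg _).trans (hW ℓ)
  rw [layersBelow_last, Fin.val_last] at h1
  calc _ ≤ _ := h1
    _ ≤ L_enc * (L * (4 * Fintype.card (WeightIndex n) * ε)) * B := by
      have := hs0.trans hs
      gcongr
    _ = _ := by ring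

end OneShot

theorem mainTheorem2 (L : ℕ) (n : Fin (L + 1) → ℕ) :
    ∃ C : ℝ, 0 < C ∧
      ∀ (Θ : Type*) (_ : Nonempty Θ) (ψ : OneShot.Nonlinearities n) (W : Θ → OneShot.Weights n)
        (s : Fin L → ℝ) (L_enc : ℝ) (𝒳 : Set (OneShot.Euc (n 0))) (B_X : ℝ) (β : ℝ),
        (∀ ℓ, LipschitzWith 1 (ψ ℓ)) →
        -- every nonlinearity but that of the output layer fixes the origin
        (∀ ℓ : Fin L, (ℓ : ℕ) + 1 < L → ψ ℓ 0 = 0) →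
        (∀ θ ℓ, ‖W θ ℓ‖ ≤ s ℓ) →
        ∏ ℓ, s ℓ ≤ L_enc →
        IsLUB ((fun q => ‖q‖) '' 𝒳) B_X →
        -- the score class
        (∀ (D : Set (OneShot.Euc (n 0) × OneShot.Euc (n (Fin.last L)))) (r : ℝ),
          (∀ x ∈ D, x.1 ∈ 𝒳) →
          (∀ x ∈ D, ∀ θ, ‖OneShot.diffFeature (OneShot.encoder ψ (W θ)) x‖ ≤ r) →
          ∀ (m : ℕ) (x : Fin m → OneShot.Euc (n 0) × OneShot.Euc (n (Fin.last L))),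
            0 < m → (∀ i, x i ∈ D) →
            OneShot.empRademacher x
                (OneShot.scoreClass β
                  fun θ => OneShot.diffFeature (OneShot.encoder ψ (W θ)))
              ≤ C * B_X * L_enc * (r / √(m : ℝ))) ∧
        -- the score class of the aggregated features
        (∀ (M : ℕ) (α : Fin (M + 1) → ℝ)
          (D : Set ((Fin (M + 1) → OneShot.Euc (n 0)) × OneShot.Euc (n (Fin.last L)))) (r : ℝ),
          (∀ ν, 0 ≤ α ν) → ∑ ν, α ν = 1 →
          (∀ x ∈ D, ∀ ν, x.1 ν ∈ 𝒳) →
          (∀ x ∈ D, ∀ θ, ‖OneShot.aggDiffFeature α (OneShot.encoder ψ (W θ)) x‖ ≤ r) →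
          ∀ (m : ℕ)
            (x : Fin m → (Fin (M + 1) → OneShot.Euc (n 0)) × OneShot.Euc (n (Fin.last L))),
            0 < m → (∀ i, x i ∈ D) →
            OneShot.empRademacher x
                (OneShot.scoreClass β
                  fun θ => OneShot.aggDiffFeature α (OneShot.encoder ψ (W θ)))
              ≤ C * B_X * L_enc * (r / √(m : ℝ))) := by
  set P : ℝ := (Fintype.card (OneShot.WeightIndex n) : ℝ)
  refine ⟨192 * (P + 1) * (P * L) + 1, by positivity, ?_⟩
  intro Θ _ ψ W s L_enc 𝒳 B_X β hψ hψ0 hW hs hB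
  have hs0 : 0 ≤ L_enc :=
    (Finset.prod_nonneg fun ℓ _ => (norm_nonneg _).trans (hW (Classical.arbitrary Θ) ℓ)).trans hs
  have hBX : ∀ q ∈ 𝒳, ‖q‖ ≤ B_X := fun q hq => hB.1 ⟨q, hq, rfl⟩
  have hc : ∀ θ j, |OneShot.weightCoords s (W θ) j - 1 / 2| ≤ 1 / 4 := fun θ j =>
    OneShot.abs_weightCoords_sub_half_le (hW θ) j
  have h0 : ∀ θ j, 0 ≤ OneShot.weightCoords s (W θ) j := fun θ j => by
    linarith [(abs_le.1 (hc θ j)).1]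
  have h1 : ∀ θ j, OneShot.weightCoords s (W θ) j < 1 := fun θ j => by
    linarith [(abs_le.1 (hc θ j)).2]
  have hconst : ∀ {r : ℝ} (m : ℕ), 0 ≤ r → 0 ≤ B_X →
      48 * (P + 1) * (4 * L * P * L_enc * B_X) * (r / √(m : ℝ))
        ≤ (192 * (P + 1) * (P * L) + 1) * B_X * L_enc * (r / √(m : ℝ)) := by
    intro r m hr hBX0
    have : 0 ≤ B_X * L_enc * (r / √(m : ℝ)) := by positivity
    linarith
  refine ⟨fun D r hD hr m x hm hx => ?_, fun M α D r hα hα1 hD hr m x hm hx => ?_⟩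
  · have hr0 : 0 ≤ r :=
      (norm_nonneg _).trans (hr _ (hx ⟨0, hm⟩) (Classical.arbitrary Θ))
    have hBX0 : 0 ≤ B_X := (norm_nonneg _).trans (hBX _ (hD _ (hx ⟨0, hm⟩)))
    refine (OneShot.empRademacher_scoreClass_le hm x β _
      (fun θ => OneShot.weightCoords s (W θ)) h0 h1 hr0
      (K := 4 * L * P * L_enc * B_X) (by positivity) (fun θ i => hr _ (hx i) θ) ?_).trans
      (hconst m hr0 hBX0)
    intro θ θ' ε hu hε i
    rw [OneShot.diffFeature, OneShot.diffFeature, sub_sub_sub_cancel_right]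
    exact OneShot.norm_encoder_sub_le hψ hψ0 (hW θ) (hW θ') hs hε hu (hBX _ (hD _ (hx i)))
  · have hr0 : 0 ≤ r :=
      (norm_nonneg _).trans (hr _ (hx ⟨0, hm⟩) (Classical.arbitrary Θ))
    have hBX0 : 0 ≤ B_X := (norm_nonneg _).trans (hBX _ (hD _ (hx ⟨0, hm⟩) 0))
    refine (OneShot.empRademacher_scoreClass_le hm x β _
      (fun θ => OneShot.weightCoords s (W θ)) h0 h1 hr0
      (K := 4 * L * P * L_enc * B_X) (by positivity) (fun θ i => hr _ (hx i) θ) ?_).trans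
      (hconst m hr0 hBX0)
    intro θ θ' ε hu hε i
    rw [OneShot.aggDiffFeature, OneShot.aggDiffFeature, sub_sub_sub_cancel_right,
      ← Finset.sum_sub_distrib]
    calc ‖∑ ν, (α ν • OneShot.encoder ψ (W θ) ((x i).1 ν)
            - α ν • OneShot.encoder ψ (W θ') ((x i).1 ν))‖
        ≤ ∑ ν, α ν * (4 * L * P * L_enc * B_X * ε) := by
          refine norm_sum_le_of_le _ fun ν _ => ?_
          rw [← smul_sub, norm_smul, Real.norm_of_nonneg (hα ν)]
          exact mul_le_mul_of_nonneg_left (OneShot.norm_encoder_sub_le hψ hψ0 (hW θ) (hW θ') hs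
            hε hu (hBX _ (hD _ (hx i) ν))) (hα ν)
      _ = 4 * L * P * L_enc * B_X * ε := by rw [← Finset.sum_mul, hα1, one_mul]
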